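/- Let $n\ge 2$, $\theta>0$ and $0\le\phi\le\pi/2$. Let $S^{n-1}$ be the unit sphere of $\mathbb{R}^n$, $e_n=(0,\dots,0,1)$, and $\mathrm{Cap}(n,\phi)=\{x\in S^{n-1}:\langle x,e_n\rangle\ge\cos\phi\}$. A $\theta$-code in a set $Z\subseteq S^{n-1}$ is a finite subset of $Z$ any two distinct points of which are at angular distance at least $\theta$. Let $A(n,\theta)$ and $A(n,\theta,\phi)$ be the maximum size of a $\theta$-code in $S^{n-1}$ and in $\mathrm{Cap}(n,\phi)$, respectively. Let $G_k^{(n)}$ ($k=0,1,\dots$) be the Gegenbauer polynomials: $G_k^{(n)}$ has degree $k$, the $G_k^{(n)}$ are pairwise orthogonal on $[-1,1]$ with weight $(1-x^2)^{(n-3)/2}$, and $G_k^{(n)}(1)=1$. For a real function $f$ on $[-1,1]$ and a $\theta$-code $Y=\{y_1,\dots,y_m\}$ in $\mathrm{Cap}(n,\phi)$ put $$H_f(Y)=f(1)+\sum_{i=1}^m f(\langle -e_n,y_i\rangle),$$ let $h_m(n,\theta,\phi,f)$ be the maximum of $H_f(Y)$ over all $\theta$-codes $Y$ in $\mathrm{Cap}(n,\phi)$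 with exactly $m$ points, and let $$h_{\max}(n,\theta,\phi,f)=\max_{0\le m\le A(n,\theta,\phi)}h_m(n,\theta,\phi,f).$$ Suppose that $f(t)=\sum_{k\ge 0}f_kG_k^{(n)}(t)$ for all $t\in[-1,1]$ (a finite sum or a convergent series), where $f_k\ge 0$ for all $k$ and $f_0>0$, and that $f(t)\le 0$ for all $t\in[-\cos\phi,\cos\theta]$. Then the maxima defining $A(n,\theta)$, $A(n,\theta,\phi)$ and $h_m(n,\theta,\phi,f)$ for $0\le m\le A(n,\theta,\phi)$ exist, and $$A(n,\theta)\le\frac{h_{\max}(n,\theta,\phi,f)}{f_0}.$$ -/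

import Mathlib

noncomputable section

namespace CapCodes

open Polynomial

/-- The Gegenbauer polynomials `G_k^{(n)}`, `n ≥ 2`, normalized by `G_k^{(n)}(1) = 1`, through
their three-term recurrence. That they are the polynomials of degree `k` orthogonal on `[-1, 1]`
with weight `(1 - x²)^((n-3)/2)` is proved in `gegenbauer_natDegree`, `gegenbauer_eval_one`
and `gegenbauer_orthogonal` below. -/
def gegenbauer (n : ℕ) : ℕ → ℝ[X]
  | 0 => 1
  | 1 => X
  | k + 2 => C ((k : ℝ) + n - 1)⁻¹ *
      (C (2 * (k : ℝ) + n) * X * gegenbauer n (k + 1) - C ((k : ℝ) + 1) * gegenbauer n k)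

theorem gegenbauer_rec (n : ℕ) (hn : 2 ≤ n) (k : ℕ) :
    ((k : ℝ[X]) + (n : ℝ[X]) - 1) * gegenbauer n (k + 2) =
      (2 * (k : ℝ[X]) + (n : ℝ[X])) * X * gegenbauer n (k + 1) - ((k : ℝ[X]) + 1) * gegenbauer n k := by
  have hn' : (2 : ℝ) ≤ n := by exact_mod_cast hn
  have h0 : ((k : ℝ) + n - 1) ≠ 0 := by
    have : (0 : ℝ) ≤ k := k.cast_nonneg
    linarith
  have h1 : ((k : ℝ[X]) + (n : ℝ[X]) - 1) = C ((k : ℝ) + n - 1) := by simp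
  rw [gegenbauer, h1, ← mul_assoc, ← C_mul, mul_inv_cancel₀ h0]
  simp only [C_1, one_mul, C_add, C_mul, map_natCast, map_ofNat]

theorem gegenbauer_eval_one (n : ℕ) (hn : 2 ≤ n) (k : ℕ) : (gegenbauer n k).eval 1 = 1 := by
  have hn' : (2 : ℝ) ≤ n := by exact_mod_cast hn
  induction k using Nat.twoStepInduction with
  | zero => simp [gegenbauer]
  | one => simp [gegenbauer]
  | more k h1 h2 =>
    have h0 : ((k : ℝ) + n - 1) ≠ 0 := by
      have : (0 : ℝ) ≤ k := k.cast_nonneg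
      linarith
    simp only [gegenbauer, eval_mul, eval_sub, eval_C, eval_X, h1, h2]
    field_simp
    ring

theorem gegenbauer_degree_aux (n : ℕ) (hn : 2 ≤ n) (k : ℕ) :
    (gegenbauer n k).natDegree ≤ k ∧ 0 < (gegenbauer n k).coeff k := by
  have hn' : (2 : ℝ) ≤ n := by exact_mod_cast hn
  induction k using Nat.twoStepInduction with
  | zero => simp [gegenbauer]
  | one => simp [gegenbauer]
  | more k h1 h2 =>
    have hk : (0 : ℝ) ≤ k := k.cast_nonneg
    have h0 : 0 < ((k : ℝ) + n - 1) := by linarith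
    have hc : (gegenbauer n k).coeff (k + 2) = 0 :=
      coeff_eq_zero_of_natDegree_lt (by omega)
    constructor
    · rw [gegenbauer]
      refine (natDegree_C_mul_le _ _).trans ((natDegree_sub_le _ _).trans (max_le ?_ ?_))
      · rw [mul_assoc]
        refine (natDegree_C_mul_le _ _).trans (natDegree_mul_le.trans ?_)
        rw [natDegree_X]
        omega
      · exact (natDegree_C_mul_le _ _).trans (by omega)
    · rw [gegenbauer, coeff_C_mul, coeff_sub, coeff_C_mul, hc, mul_assoc, coeff_C_mul,
        coeff_X_mul]
      have := h2.2
      have h3 : 0 < 2 * (k : ℝ) + n := by linarith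
      simp only [mul_zero, sub_zero]
      positivity

theorem gegenbauer_natDegree (n : ℕ) (hn : 2 ≤ n) (k : ℕ) : (gegenbauer n k).natDegree = k := by
  obtain ⟨h1, h2⟩ := gegenbauer_degree_aux n hn k
  exact le_antisymm h1 (le_natDegree_of_ne_zero h2.ne')

/-- `(1 - t²) G_{k+1}' = (k+1) (G_k - t G_{k+1})`. -/
theorem gegenbauer_derivative (n : ℕ) (hn : 2 ≤ n) (k : ℕ) :
    (1 - X ^ 2) * derivative (gegenbauer n (k + 1)) =
      ((k : ℝ[X]) + 1) * (gegenbauer n k - X * gegenbauer n (k + 1)) ∧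
    (1 - X ^ 2) * derivative (gegenbauer n k) =
      ((k : ℝ[X]) + (n : ℝ[X]) - 2) * (X * gegenbauer n k - gegenbauer n (k + 1)) := by
  induction k with
  | zero =>
    constructor
    · simp [gegenbauer]; ring
    · simp [gegenbauer]
  | succ k ih =>
    obtain ⟨h1, h2⟩ := ih
    have hr := gegenbauer_rec n hn k
    have hn' : (2 : ℝ) ≤ n := by exact_mod_cast hn
    have h0 : ((k : ℝ[X]) + (n : ℝ[X]) - 1) ≠ 0 := by
      have h1 : ((k : ℝ[X]) + (n : ℝ[X]) - 1) = C ((k : ℝ) + n - 1) := by simp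
      rw [h1, Ne, C_eq_zero]
      have : (0 : ℝ) ≤ k := k.cast_nonneg
      linarith
    have hd := congrArg derivative hr
    simp only [derivative_mul, derivative_sub, derivative_add, derivative_natCast,
      derivative_one, derivative_X, derivative_ofNat] at hd
    constructor
    · apply mul_left_cancel₀ h0
      push_cast
      linear_combination (1 - X ^ 2) * hd + (2 * (k : ℝ[X]) + (n : ℝ[X])) * X * h1 -
        ((k : ℝ[X]) + 1) * h2 + (((k : ℝ[X]) + 2) * X) * hr
    · push_cast
      linear_combination h1 + hr

/-- The Gegenbauer differential equation. -/
theorem gegenbauer_ode (n : ℕ) (hn : 2 ≤ n) (k : ℕ) :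
    (1 - X ^ 2) * derivative (derivative (gegenbauer n k)) =
      ((n : ℝ[X]) - 1) * X * derivative (gegenbauer n k) -
        (k : ℝ[X]) * ((k : ℝ[X]) + (n : ℝ[X]) - 2) * gegenbauer n k := by
  cases k with
  | zero => simp [gegenbauer]
  | succ k =>
    obtain ⟨h1, h2⟩ := gegenbauer_derivative n hn k
    have hd := congrArg derivative h1
    simp only [derivative_mul, derivative_sub, derivative_add, derivative_natCast,
      derivative_one, derivative_X, derivative_pow] at hd
    have h0 : (1 - X ^ 2 : ℝ[X]) ≠ 0 := by
      intro h
      have := congrArg (eval 0) h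
      simp at this
    apply mul_left_cancel₀ h0
    push_cast at hd ⊢
    rw [map_ofNat] at hd
    linear_combination (1 - X ^ 2) * hd + (2 - (k : ℝ[X]) - (n : ℝ[X])) * X * h1 +
      ((k : ℝ[X]) + 1) * h2

theorem weight_intervalIntegrable (n : ℕ) (hn : 2 ≤ n) :
    IntervalIntegrable (fun x : ℝ => (1 - x ^ 2) ^ (((n : ℝ) - 3) / 2)) MeasureTheory.volume
      (-1) 1 := by
  rcases hn.eq_or_lt with rfl | hn
  · have h : IntervalIntegrable (fun x : ℝ => 1 / √(1 - x ^ 2)) MeasureTheory.volume (-1) 1 := by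
      refine intervalIntegral.intervalIntegrable_deriv_of_nonneg (g := Real.arcsin)
        Real.continuous_arcsin.continuousOn ?_ ?_
      · intro x hx
        rw [min_eq_left (by norm_num), max_eq_right (by norm_num)] at hx
        exact Real.hasDerivAt_arcsin hx.1.ne' hx.2.ne
      · intro x _
        positivity
    refine h.congr ?_
    intro x hx
    rw [Set.uIoc_of_le (by norm_num)] at hx
    have h0 : 0 ≤ 1 - x ^ 2 := by nlinarith [hx.1, hx.2]
    have h2 : (((2 : ℕ) : ℝ) - 3) / 2 = -(1 / 2) := by norm_num
    simp only [h2]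
    rw [Real.rpow_neg h0, ← Real.sqrt_eq_rpow, one_div]
  · have h3 : (3 : ℝ) ≤ n := by exact_mod_cast hn
    have hc : Continuous (fun x : ℝ => (1 - x ^ 2) ^ (((n : ℝ) - 3) / 2)) :=
      (continuous_const.sub (continuous_pow 2)).rpow_const (fun x => Or.inr (by linarith))
    exact hc.intervalIntegrable _ _

theorem gegenbauer_orthogonal (n : ℕ) (hn : 2 ≤ n) {k l : ℕ} (hkl : k ≠ l) :
    ∫ x in (-1 : ℝ)..1, (gegenbauer n k).eval x * (gegenbauer n l).eval x *
      (1 - x ^ 2) ^ (((n : ℝ) - 3) / 2) = 0 := by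
  have hn' : (2 : ℝ) ≤ n := by exact_mod_cast hn
  set P := gegenbauer n k with hP
  set Q := gegenbauer n l with hQ
  set a : ℝ := ((n : ℝ) - 3) / 2 with ha
  set c : ℝ := (l : ℝ) * (l + n - 2) - k * (k + n - 2) with hc
  have hc0 : c ≠ 0 := by
    have h1 : c = ((l : ℝ) - k) * (l + k + n - 2) := by rw [hc]; ring
    rw [h1]
    refine mul_ne_zero (sub_ne_zero.2 (by exact_mod_cast hkl.symm)) ?_
    have h2 : (1 : ℝ) ≤ l + k := by
      have : 1 ≤ l + k := by omega
      exact_mod_cast this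
    linarith
  have hode (m : ℕ) (x : ℝ) := congrArg (eval x) (gegenbauer_ode n hn m)
  simp only [eval_mul, eval_sub, eval_add, eval_pow, eval_X, eval_natCast, eval_one,
    eval_ofNat] at hode
  have hint : IntervalIntegrable
      (fun x : ℝ => c * (P.eval x * Q.eval x * (1 - x ^ 2) ^ a)) MeasureTheory.volume (-1) 1 := by
    refine IntervalIntegrable.const_mul ?_ c
    exact (weight_intervalIntegrable n hn).continuousOn_mul
      (P.continuous.mul Q.continuous).continuousOn
  have hcont : ContinuousOn (fun x : ℝ => (1 - x ^ 2) ^ (a + 1) *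
      (P.derivative.eval x * Q.eval x - P.eval x * Q.derivative.eval x)) (Set.Icc (-1) 1) := by
    refine Continuous.continuousOn (Continuous.mul ?_ ?_)
    · exact (continuous_const.sub (continuous_pow 2)).rpow_const
        (fun x => Or.inr (by rw [ha]; linarith))
    · exact (P.derivative.continuous.mul Q.continuous).sub
        (P.continuous.mul Q.derivative.continuous)
  have hderiv : ∀ x ∈ Set.Ioo (-1 : ℝ) 1, HasDerivAt (fun x : ℝ => (1 - x ^ 2) ^ (a + 1) *
      (P.derivative.eval x * Q.eval x - P.eval x * Q.derivative.eval x))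
      (c * (P.eval x * Q.eval x * (1 - x ^ 2) ^ a)) x := by
    intro x hx
    have h0 : 0 < 1 - x ^ 2 := by nlinarith [hx.1, hx.2]
    have h1 : HasDerivAt (fun x : ℝ => 1 - x ^ 2) (-(2 * x)) x := by
      simpa using (hasDerivAt_pow 2 x).const_sub 1
    have h2 := h1.rpow_const (p := a + 1) (Or.inl h0.ne')
    have h3 := ((P.derivative.hasDerivAt x).mul (Q.hasDerivAt x)).sub
      ((P.hasDerivAt x).mul (Q.derivative.hasDerivAt x))
    refine (h2.mul h3).congr_deriv ?_
    have h4 : (1 - x ^ 2) ^ (a + 1) = (1 - x ^ 2) ^ a * (1 - x ^ 2) := Real.rpow_add_one h0.ne' a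
    have h5 : a + 1 - 1 = a := by ring
    have hk := hode k x
    have hl := hode l x
    have h6 : 2 * (a + 1) = (n : ℝ) - 1 := by rw [ha]; ring
    rw [← hP] at hk
    rw [← hQ] at hl
    simp only [Pi.mul_apply, Pi.sub_apply, h4, h5, hc]
    linear_combination (1 - x ^ 2) ^ a * Q.eval x * hk - (1 - x ^ 2) ^ a * P.eval x * hl -
      (1 - x ^ 2) ^ a * x *
        (P.derivative.eval x * Q.eval x - P.eval x * Q.derivative.eval x) * h6
  have hftc := intervalIntegral.integral_eq_sub_of_hasDerivAt_of_le (by norm_num) hcont hderiv hint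
  rw [intervalIntegral.integral_const_mul] at hftc
  have h7 : a + 1 ≠ 0 := by rw [ha]; intro h; linarith
  have h8 : (1 - (1 : ℝ) ^ 2) ^ (a + 1) = 0 := by norm_num [Real.zero_rpow h7]
  have h9 : (1 - (-1 : ℝ) ^ 2) ^ (a + 1) = 0 := by norm_num [Real.zero_rpow h7]
  rw [h8, h9, zero_mul, zero_mul, sub_zero] at hftc
  exact (mul_eq_zero.1 hftc).resolve_left hc0

/-- The north pole `e_n = (0, …, 0, 1)`. -/
def northPole (n : ℕ) : EuclideanSpace ℝ (Fin n) :=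
  WithLp.toLp 2 (fun i => if (i : ℕ) + 1 = n then 1 else 0)

/-- The strip `Z(n, [ψ, φ])` on the unit sphere of `ℝⁿ`. -/
def strip (n : ℕ) (ψ φ : ℝ) : Set (EuclideanSpace ℝ (Fin n)) :=
  {x | ‖x‖ = 1 ∧ Real.cos φ ≤ inner ℝ x (northPole n) ∧ inner ℝ x (northPole n) ≤ Real.cos ψ}

/-- The spherical cap `Cap(n, φ)`. -/
def cap (n : ℕ) (φ : ℝ) : Set (EuclideanSpace ℝ (Fin n)) := strip n 0 φ

/-- `C` is a `θ`-code in the subset `Z` of the sphere: a finite subset whose distinct points are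
at angular distance at least `θ`. -/
def IsCode {n : ℕ} (θ : ℝ) (Z : Set (EuclideanSpace ℝ (Fin n)))
    (C : Finset (EuclideanSpace ℝ (Fin n))) : Prop :=
  (C : Set (EuclideanSpace ℝ (Fin n))) ⊆ Z ∧
    ∀ x ∈ C, ∀ y ∈ C, x ≠ y → θ ≤ InnerProductGeometry.angle x y

/-- The sizes of the `θ`-codes in `Z`. -/
def codeSizes {n : ℕ} (θ : ℝ) (Z : Set (EuclideanSpace ℝ (Fin n))) : Set ℕ :=
  {m | ∃ C, IsCode θ Z C ∧ C.card = m}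

/-- `A(n, θ, φ)`, the maximum size of a `θ`-code in `Cap(n, φ)`. -/
def maxCapCode (n : ℕ) (θ φ : ℝ) : ℕ := sSup (codeSizes θ (cap n φ))

/-- `A(n, θ)`, the maximum size of a `θ`-code in the unit sphere `S^{n-1}`. -/
def maxSphericalCode (n : ℕ) (θ : ℝ) : ℕ :=
  sSup (codeSizes θ (Metric.sphere (0 : EuclideanSpace ℝ (Fin n)) 1))

/-- `H_f(Y) = f(1) + ∑_{y ∈ Y} f(⟨-e_n, y⟩)`. -/
def H (n : ℕ) (f : ℝ → ℝ) (Y : Finset (EuclideanSpace ℝ (Fin n))) : ℝ :=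
  f 1 + ∑ y ∈ Y, f (inner ℝ (-northPole n) y)

/-- The values `H_f(Y)` at the `θ`-codes `Y` in `Cap(n, φ)` with exactly `m` points. -/
def hValues (n : ℕ) (θ φ : ℝ) (f : ℝ → ℝ) (m : ℕ) : Set ℝ :=
  {v | ∃ Y, IsCode θ (cap n φ) Y ∧ Y.card = m ∧ H n f Y = v}

/-- `h_m(n, θ, φ, f)`, the maximum of `H_f` over the `m`-point `θ`-codes in `Cap(n, φ)`. -/
def h (n : ℕ) (θ φ : ℝ) (f : ℝ → ℝ) (m : ℕ) : ℝ := sSup (hValues n θ φ f m)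

/-- `h_max(n, θ, φ, f)`, the maximum of `h_m(n, θ, φ, f)` over `0 ≤ m ≤ A(n, θ, φ)`. -/
def hMax (n : ℕ) (θ φ : ℝ) (f : ℝ → ℝ) : ℝ :=
  (Finset.range (maxCapCode n θ φ + 1)).sup' Finset.nonempty_range_add_one (h n θ φ f)

end CapCodes

end

/-! Delsarte's argument: for a largest `θ`-code of size N, bound the sum S of f(⟨x, y⟩) over all
ordered pairs of code points, diagonal included, from both sides. From below (`mul_card_sq_le_sum`),
every G_k is a positive definite kernel on the sphere, so dropping all terms of the expansion except
k = 0 leaves S ≥ f_0 N². From above (`sum_inner_le_hMax`), fix x. A code point y ≠ x can contribute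
positively only if ⟨x, y⟩ < -cos φ, that is, if it lies in the cap of radius φ about -x. Rotating -x
to the pole makes these points a code Y in `cap n φ`, so the row of x sums to at most H_f(Y) ≤
h_max. Hence f_0 N² ≤ N h_max.

Positive definiteness (`gegenbauer_posDef`) is obtained algebraically. The zonal polynomial Z_y,
with the Gegenbauer recurrence homogenized by |X|², is harmonic and represents evaluation at y for
the Fischer inner product. The kernel G_k(⟨x, y⟩) is thus a positive multiple of a Gram matrix. The
maxima exist by compactness, the series converging uniformly on the sphere. -/

namespace CapCodes

/-! ### Zonal polynomials and their harmonicity -/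

section Zonal

open MvPolynomial

variable {n : ℕ}

/-- The linear form `⟨y, X⟩`. -/
noncomputable def linearForm (y : Fin n → ℝ) : MvPolynomial (Fin n) ℝ := ∑ i, C (y i) * X i

/-- The quadratic form `|X|²`. -/
noncomputable def normSqForm (n : ℕ) : MvPolynomial (Fin n) ℝ := ∑ i, X i ^ 2

/-- The derivative in the direction `y`. -/
noncomputable def dirDeriv (y : Fin n → ℝ) (p : MvPolynomial (Fin n) ℝ) :
    MvPolynomial (Fin n) ℝ := ∑ i, C (y i) * pderiv i p

/-- The Laplacian on polynomials. -/
noncomputable def laplacian (p : MvPolynomial (Fin n) ℝ) : MvPolynomial (Fin n) ℝ :=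
  ∑ i, pderiv i (pderiv i p)

/-- The zonal harmonic of degree `k` with pole `y`, through the recurrence of the Gegenbauer
polynomials. -/
noncomputable def zonal (y : Fin n → ℝ) : ℕ → MvPolynomial (Fin n) ℝ
  | 0 => 1
  | 1 => linearForm y
  | k + 2 => C ((k : ℝ) + n - 1)⁻¹ *
      (C (2 * (k : ℝ) + n) * (linearForm y * zonal y (k + 1)) -
        C ((k : ℝ) + 1) * (normSqForm n * zonal y k))

theorem dirDeriv_sub (y : Fin n → ℝ) (p q : MvPolynomial (Fin n) ℝ) :
    dirDeriv y (p - q) = dirDeriv y p - dirDeriv y q := by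
  simp [dirDeriv, mul_sub, Finset.sum_sub_distrib]

theorem dirDeriv_mul (y : Fin n → ℝ) (p q : MvPolynomial (Fin n) ℝ) :
    dirDeriv y (p * q) = dirDeriv y p * q + p * dirDeriv y q := by
  simp only [dirDeriv, Finset.mul_sum, Finset.sum_mul, ← Finset.sum_add_distrib]
  refine Finset.sum_congr rfl fun i _ => ?_
  rw [pderiv_mul]
  ring

theorem dirDeriv_C (y : Fin n → ℝ) (c : ℝ) : dirDeriv y (C c) = 0 := by
  simp [dirDeriv]

theorem pderiv_linearForm (y : Fin n → ℝ) (i : Fin n) : pderiv i (linearForm y) = C (y i) := by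
  simp [linearForm, pderiv_X, Pi.single_apply]

theorem pderiv_normSqForm (i : Fin n) : pderiv i (normSqForm n) = 2 * X i := by
  simp [normSqForm, pderiv_X, Pi.single_apply]

theorem dirDeriv_linearForm {y : Fin n → ℝ} (hy : ∑ i, y i ^ 2 = 1) :
    dirDeriv y (linearForm y) = 1 := by
  simp only [dirDeriv, pderiv_linearForm, ← pow_two, ← C_pow, ← map_sum, hy, C_1]

theorem dirDeriv_normSqForm (y : Fin n → ℝ) :
    dirDeriv y (normSqForm n) = 2 * linearForm y := by
  simp only [dirDeriv, pderiv_normSqForm, linearForm, Finset.mul_sum]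
  exact Finset.sum_congr rfl fun i _ => by ring

theorem laplacian_sub (p q : MvPolynomial (Fin n) ℝ) :
    laplacian (p - q) = laplacian p - laplacian q := by
  simp [laplacian, Finset.sum_sub_distrib]

theorem laplacian_C_mul (c : ℝ) (p : MvPolynomial (Fin n) ℝ) :
    laplacian (C c * p) = C c * laplacian p := by
  simp [laplacian, Finset.mul_sum]

theorem laplacian_linearForm_mul (y : Fin n → ℝ) (p : MvPolynomial (Fin n) ℝ) :
    laplacian (linearForm y * p) = 2 * dirDeriv y p + linearForm y * laplacian p := by
  simp only [laplacian, dirDeriv, Finset.mul_sum, ← Finset.sum_add_distrib]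
  refine Finset.sum_congr rfl fun i _ => ?_
  simp only [pderiv_mul, pderiv_linearForm, map_add, pderiv_C]
  ring

/-- Euler's identity turns the cross term 4 ∑ X_i ∂_i p into 4k p; the Laplacian of |X|² supplies
the remaining 2n. -/
theorem laplacian_normSqForm_mul {p : MvPolynomial (Fin n) ℝ} {k : ℕ} (hp : p.IsHomogeneous k) :
    laplacian (normSqForm n * p) =
      C (2 * (2 * (k : ℝ) + n)) * p + normSqForm n * laplacian p := by
  have hE := hp.sum_X_mul_pderiv
  have h1 (i : Fin n) : pderiv i (pderiv i (normSqForm n * p)) =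
      2 * p + 4 * (X i * pderiv i p) + normSqForm n * pderiv i (pderiv i p) := by
    have h2 : pderiv i (2 : MvPolynomial (Fin n) ℝ) = 0 := by
      rw [← map_ofNat (C : ℝ →+* MvPolynomial (Fin n) ℝ) 2, pderiv_C]
    simp only [pderiv_mul, pderiv_normSqForm, map_add, pderiv_X_self, h2]
    ring
  simp only [laplacian, h1, Finset.sum_add_distrib, ← Finset.mul_sum, hE]
  simp only [Finset.sum_const, Finset.card_univ, Fintype.card_fin, nsmul_eq_mul, C_mul, C_add,
    map_natCast, map_ofNat]
  ring

theorem laplacian_dirDeriv (y : Fin n → ℝ) (p : MvPolynomial (Fin n) ℝ) :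
    laplacian (dirDeriv y p) = dirDeriv y (laplacian p) := by
  simp only [laplacian, dirDeriv, map_sum, pderiv_C_mul, Finset.mul_sum]
  rw [Finset.sum_comm]
  refine Finset.sum_congr rfl fun i _ => Finset.sum_congr rfl fun j _ => ?_
  have hc (q : MvPolynomial (Fin n) ℝ) : pderiv j (pderiv i q) = pderiv i (pderiv j q) := by
    have h : ⁅pderiv (R := ℝ) j, pderiv i⁆ = 0 := derivation_ext fun l => by
      rw [Derivation.commutator_apply, pderiv_X, pderiv_X]
      simp only [Pi.single_apply]
      split_ifs <;> simp
    have h' := congrArg (fun D => D q) h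
    rw [Derivation.commutator_apply] at h'
    exact sub_eq_zero.1 h'
  rw [hc, hc]

theorem isHomogeneous_linearForm (y : Fin n → ℝ) : (linearForm y).IsHomogeneous 1 :=
  IsHomogeneous.sum _ _ _ fun _ _ => isHomogeneous_C_mul_X _ _

theorem isHomogeneous_normSqForm : (normSqForm n).IsHomogeneous 2 :=
  IsHomogeneous.sum _ _ _ fun _ _ => isHomogeneous_X_pow _ _

theorem isHomogeneous_dirDeriv (y : Fin n → ℝ) {p : MvPolynomial (Fin n) ℝ} {k : ℕ}
    (hp : p.IsHomogeneous (k + 1)) : (dirDeriv y p).IsHomogeneous k :=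
  IsHomogeneous.sum _ _ _ fun i _ => (hp.pderiv (i := i)).C_mul (y i)

theorem isHomogeneous_zonal (y : Fin n → ℝ) (k : ℕ) : (zonal y k).IsHomogeneous k := by
  induction k using Nat.twoStepInduction with
  | zero => exact isHomogeneous_one _ _
  | one => exact isHomogeneous_linearForm y
  | more k h1 h2 =>
    rw [zonal]
    refine IsHomogeneous.C_mul (IsHomogeneous.sub (IsHomogeneous.C_mul ?_ _)
      (IsHomogeneous.C_mul ?_ _)) _
    · have := (isHomogeneous_linearForm y).mul h2
      rwa [show 1 + (k + 1) = k + 2 by omega] at this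
    · have := (isHomogeneous_normSqForm (n := n)).mul h1
      rwa [show 2 + k = k + 2 by omega] at this

theorem zonal_rec (hn : 2 ≤ n) (y : Fin n → ℝ) (k : ℕ) :
    C ((k : ℝ) + n - 1) * zonal y (k + 2) =
      C (2 * (k : ℝ) + n) * (linearForm y * zonal y (k + 1)) -
        C ((k : ℝ) + 1) * (normSqForm n * zonal y k) := by
  have hn' : (2 : ℝ) ≤ n := by exact_mod_cast hn
  have h0 : ((k : ℝ) + n - 1) ≠ 0 := by
    have : (0 : ℝ) ≤ k := k.cast_nonneg
    linarith
  rw [zonal, ← mul_assoc, ← C_mul, mul_inv_cancel₀ h0, C_1, one_mul]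

/-- Differentiate the three-term recurrence along y; by induction the lower terms recombine into the
recurrence one degree below. This evaluates the cross term in `laplacian_zonal`. -/
theorem dirDeriv_zonal (hn : 2 ≤ n) {y : Fin n → ℝ} (hy : ∑ i, y i ^ 2 = 1) (k : ℕ) :
    dirDeriv y (zonal y (k + 1)) = C ((k : ℝ) + 1) * zonal y k := by
  have hn' : (2 : ℝ) ≤ n := by exact_mod_cast hn
  have hne (k : ℕ) : (C ((k : ℝ) + n - 1) : MvPolynomial (Fin n) ℝ) ≠ 0 := by
    rw [Ne, C_eq_zero]
    have : (0 : ℝ) ≤ k := k.cast_nonneg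
    linarith
  induction k using Nat.strong_induction_on with
  | _ k ih =>
    match k with
    | 0 => simp [zonal, dirDeriv_linearForm hy]
    | 1 =>
      apply mul_left_cancel₀ (hne 0)
      have h0 := congrArg (dirDeriv y) (zonal_rec hn y 0)
      simp only [dirDeriv_sub, dirDeriv_mul, dirDeriv_C, zero_mul, zero_add, dirDeriv_normSqForm,
        dirDeriv_linearForm hy, ih 0 (by omega)] at h0
      rw [h0]
      have h1 : dirDeriv y (zonal y 0) = 0 := by simp [zonal, dirDeriv]
      rw [h1]
      simp [zonal]
      ring
    | k + 2 =>
      apply mul_left_cancel₀ (hne (k + 1))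
      have h0 := congrArg (dirDeriv y) (zonal_rec hn y (k + 1))
      simp only [dirDeriv_sub, dirDeriv_mul, dirDeriv_C, zero_mul, zero_add, dirDeriv_normSqForm,
        dirDeriv_linearForm hy, ih (k + 1) (by omega), ih k (by omega)] at h0
      rw [h0]
      have h1 := zonal_rec hn y k
      simp only [C_mul, C_add, C_sub, C_1, map_natCast, map_ofNat, Nat.cast_add, Nat.cast_one,
        Nat.cast_ofNat] at h1 ⊢
      linear_combination (-((k : MvPolynomial (Fin n) ℝ) + 2)) * h1

/-- Apply the Laplacian to the recurrence: both products contribute 2(2k + n)(k + 1) Z_k, with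
opposite signs. -/
theorem laplacian_zonal (hn : 2 ≤ n) {y : Fin n → ℝ} (hy : ∑ i, y i ^ 2 = 1) (k : ℕ) :
    laplacian (zonal y k) = 0 := by
  induction k using Nat.twoStepInduction with
  | zero => simp [zonal, laplacian]
  | one => simp [zonal, laplacian, pderiv_linearForm]
  | more k h1 h2 =>
    rw [zonal, laplacian_C_mul, laplacian_sub, laplacian_C_mul, laplacian_C_mul,
      laplacian_linearForm_mul, laplacian_normSqForm_mul (isHomogeneous_zonal y k), h1, h2,
      dirDeriv_zonal hn hy]
    simp only [C_mul, C_add, C_1, map_natCast, map_ofNat]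
    ring

/-! ### The Fischer inner product and the reproducing property -/

/-- The Fischer inner product `∑_α α! p_α q_α`. -/
noncomputable def fischer (p q : MvPolynomial (Fin n) ℝ) : ℝ :=
  ∑ α ∈ p.support, coeff α p * ((∏ i, ((α i).factorial : ℝ)) * coeff α q)

theorem fischer_eq_sum {p : MvPolynomial (Fin n) ℝ} {s : Finset (Fin n →₀ ℕ)}
    (hs : p.support ⊆ s) (q : MvPolynomial (Fin n) ℝ) :
    fischer p q = ∑ α ∈ s, coeff α p * ((∏ i, ((α i).factorial : ℝ)) * coeff α q) :=
  Finset.sum_subset hs fun α _ h => by rw [notMem_support_iff.1 h, zero_mul]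

theorem fischer_add_left (p p' q : MvPolynomial (Fin n) ℝ) :
    fischer (p + p') q = fischer p q + fischer p' q := by
  classical
  rw [fischer_eq_sum (support_add (p := p) (q := p')),
    fischer_eq_sum (Finset.subset_union_left (s₂ := p'.support)),
    fischer_eq_sum (Finset.subset_union_right (s₁ := p.support)), ← Finset.sum_add_distrib]
  exact Finset.sum_congr rfl fun α _ => by rw [coeff_add]; ring

theorem fischer_add_right (p q q' : MvPolynomial (Fin n) ℝ) :
    fischer p (q + q') = fischer p q + fischer p q' := by
  simp only [fischer, ← Finset.sum_add_distrib]
  exact Finset.sum_congr rfl fun α _ => by rw [coeff_add]; ring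

theorem fischer_C_mul_right (c : ℝ) (p q : MvPolynomial (Fin n) ℝ) :
    fischer p (C c * q) = c * fischer p q := by
  simp only [fischer, Finset.mul_sum]
  exact Finset.sum_congr rfl fun α _ => by rw [coeff_C_mul]; ring

theorem fischer_C_mul_left (c : ℝ) (p q : MvPolynomial (Fin n) ℝ) :
    fischer (C c * p) q = c * fischer p q := by
  have h : (C c * p).support ⊆ p.support := by
    rw [← smul_eq_C_mul]
    exact support_smul
  rw [fischer_eq_sum h, fischer, Finset.mul_sum]
  exact Finset.sum_congr rfl fun α _ => by rw [coeff_C_mul]; ring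

theorem fischer_sub_left (p p' q : MvPolynomial (Fin n) ℝ) :
    fischer (p - p') q = fischer p q - fischer p' q := by
  have h : p - p' = p + C (-1) * p' := by simp [sub_eq_add_neg]
  rw [h, fischer_add_left, fischer_C_mul_left]
  ring

theorem fischer_sum_left {ι : Type*} (s : Finset ι) (p : ι → MvPolynomial (Fin n) ℝ)
    (q : MvPolynomial (Fin n) ℝ) : fischer (∑ i ∈ s, p i) q = ∑ i ∈ s, fischer (p i) q := by
  classical
  induction s using Finset.induction_on with
  | empty => simp [fischer]
  | insert i s hi ih => rw [Finset.sum_insert hi, Finset.sum_insert hi, fischer_add_left, ih]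

theorem fischer_sum_right {ι : Type*} (s : Finset ι) (p : MvPolynomial (Fin n) ℝ)
    (q : ι → MvPolynomial (Fin n) ℝ) : fischer p (∑ i ∈ s, q i) = ∑ i ∈ s, fischer p (q i) := by
  classical
  induction s using Finset.induction_on with
  | empty => simp [fischer]
  | insert i s hi ih => rw [Finset.sum_insert hi, Finset.sum_insert hi, fischer_add_right, ih]

theorem fischer_self_nonneg (p : MvPolynomial (Fin n) ℝ) : 0 ≤ fischer p p :=
  Finset.sum_nonneg fun α _ => by
    rw [mul_left_comm]
    exact mul_nonneg (Finset.prod_nonneg fun i _ => Nat.cast_nonneg _) (mul_self_nonneg _)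

theorem fischer_monomial_left (α : Fin n →₀ ℕ) (c : ℝ) (q : MvPolynomial (Fin n) ℝ) :
    fischer (monomial α c) q = c * ((∏ i, ((α i).factorial : ℝ)) * coeff α q) := by
  rw [fischer_eq_sum support_monomial_subset, Finset.sum_singleton, coeff_monomial, if_pos rfl]

/-- Multiplication by `X i` is adjoint to the `i`-th partial derivative. -/
theorem fischer_X_mul_left (i : Fin n) (p q : MvPolynomial (Fin n) ℝ) :
    fischer (X i * p) q = fischer p (pderiv i q) := by
  induction p using MvPolynomial.induction_on' with
  | monomial α c =>
    rw [X, monomial_mul, one_mul, fischer_monomial_left, fischer_monomial_left, coeff_pderiv]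
    have h : (∏ j, (((Finsupp.single i 1 + α : Fin n →₀ ℕ) j).factorial : ℝ)) =
        ((α i : ℝ) + 1) * ∏ j, ((α j).factorial : ℝ) := by
      rw [← Finset.mul_prod_erase _ _ (Finset.mem_univ i),
        ← Finset.mul_prod_erase (a := i) (f := fun j => ((α j).factorial : ℝ)) _
          (Finset.mem_univ i), ← mul_assoc]
      congr 1
      · simp [add_comm 1, Nat.factorial_succ]
      · refine Finset.prod_congr rfl fun j hj => ?_
        simp [(Finset.ne_of_mem_erase hj).symm]
    rw [h, add_comm (Finsupp.single i 1)]
    ring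
  | add p p' h h' => rw [mul_add, fischer_add_left, fischer_add_left, h, h']

theorem fischer_linearForm_mul_left (y : Fin n → ℝ) (p q : MvPolynomial (Fin n) ℝ) :
    fischer (linearForm y * p) q = fischer p (dirDeriv y q) := by
  simp only [linearForm, dirDeriv, Finset.sum_mul, fischer_sum_left, fischer_sum_right, mul_assoc,
    fischer_C_mul_left, fischer_C_mul_right, fischer_X_mul_left]

/-- Consequently multiples of |X|² are orthogonal to harmonic polynomials, which removes the second
term of the zonal recurrence. -/
theorem fischer_normSqForm_mul_left (p q : MvPolynomial (Fin n) ℝ) :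
    fischer (normSqForm n * p) q = fischer p (laplacian q) := by
  simp only [normSqForm, laplacian, Finset.sum_mul, fischer_sum_left, fischer_sum_right,
    pow_two, mul_assoc, fischer_X_mul_left]

theorem eval_dirDeriv {p : MvPolynomial (Fin n) ℝ} {k : ℕ} (hp : p.IsHomogeneous k)
    (y : Fin n → ℝ) : eval y (dirDeriv y p) = k * eval y p := by
  have h := congrArg (eval y) hp.sum_X_mul_pderiv
  simpa [dirDeriv] using h

theorem fischer_one_left (y : Fin n → ℝ) {q : MvPolynomial (Fin n) ℝ} (hq : q.IsHomogeneous 0) :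
    fischer 1 q = eval y q := by
  have h : q = C (coeff 0 q) := totalDegree_eq_zero_iff_eq_C.1 (by
    simpa using hq.totalDegree_le)
  have h1 : (1 : MvPolynomial (Fin n) ℝ) = monomial 0 1 := rfl
  rw [h1, fischer_monomial_left]
  conv_rhs => rw [h, eval_C]
  simp

/-- The zonal harmonic with pole `y` represents, up to a positive factor, the evaluation of
harmonic polynomials at `y`. -/
theorem exists_fischer_zonal (hn : 2 ≤ n) (k : ℕ) : ∃ c : ℝ, 0 < c ∧
    ∀ (y : Fin n → ℝ) (q : MvPolynomial (Fin n) ℝ), q.IsHomogeneous k → laplacian q = 0 →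
      fischer (zonal y k) q = c * eval y q := by
  have hn' : (2 : ℝ) ≤ n := by exact_mod_cast hn
  induction k with
  | zero => exact ⟨1, one_pos, fun y q hq _ => by rw [zonal, fischer_one_left y hq, one_mul]⟩
  | succ k ih =>
    obtain ⟨c, hc, h⟩ := ih
    match k with
    | 0 =>
      refine ⟨1, one_pos, fun y q hq _ => ?_⟩
      rw [zonal, ← mul_one (linearForm y), fischer_linearForm_mul_left,
        fischer_one_left y (isHomogeneous_dirDeriv y hq), eval_dirDeriv hq]
      simp
    | k + 1 =>
      have hk : (0 : ℝ) ≤ k := k.cast_nonneg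
      have h0 : 0 < (k : ℝ) + n - 1 := by linarith
      -- The factor k + 2 comes from Euler's identity for ∂_y q at y, q having degree k + 2; the
      -- others are the recurrence coefficients. The constant must not depend on y, since it is
      -- shared by all points of a code.
      refine ⟨((k : ℝ) + n - 1)⁻¹ * ((2 * (k : ℝ) + n) * (c * ((k : ℝ) + 2))), by positivity,
        fun y q hq hl => ?_⟩
      have hl' : laplacian (dirDeriv y q) = 0 := by
        rw [laplacian_dirDeriv, hl]
        simp [dirDeriv]
      rw [zonal, fischer_C_mul_left, fischer_sub_left, fischer_C_mul_left, fischer_C_mul_left,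
        fischer_linearForm_mul_left, fischer_normSqForm_mul_left, hl,
        h y _ (isHomogeneous_dirDeriv y hq) hl', eval_dirDeriv hq]
      have h1 : fischer (zonal y k) 0 = 0 := by simp [fischer]
      rw [h1]
      push_cast
      ring

/-- At a unit vector |X|² evaluates to 1, and the two recurrences coincide. -/
theorem eval_zonal {y z : Fin n → ℝ} (hz : ∑ i, z i ^ 2 = 1) (k : ℕ) :
    eval z (zonal y k) = (gegenbauer n k).eval (∑ i, y i * z i) := by
  have h1 : eval z (linearForm y) = ∑ i, y i * z i := by simp [linearForm]
  have h2 : eval z (normSqForm n) = 1 := by simp [normSqForm, hz]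
  induction k using Nat.twoStepInduction with
  | zero => simp [zonal, gegenbauer]
  | one => simp [zonal, gegenbauer, h1]
  | more k ih1 ih2 =>
    simp only [zonal, gegenbauer, map_mul, map_sub, eval_C, h1, h2, ih1, ih2,
      Polynomial.eval_mul, Polynomial.eval_sub, Polynomial.eval_C, Polynomial.eval_X]
    ring

end Zonal

/-! ### Positive definiteness of the Gegenbauer kernels -/

/-- Schoenberg's theorem: the Gegenbauer polynomials are positive definite on the sphere. -/
theorem gegenbauer_posDef {n : ℕ} (hn : 2 ≤ n) (k : ℕ) {ι : Type*} (s : Finset ι)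
    (x : ι → EuclideanSpace ℝ (Fin n)) (hx : ∀ i ∈ s, ‖x i‖ = 1) (w : ι → ℝ) :
    0 ≤ ∑ i ∈ s, ∑ j ∈ s, w i * w j * (gegenbauer n k).eval (inner ℝ (x i) (x j)) := by
  obtain ⟨c, hc, h⟩ := exists_fischer_zonal hn k
  have hx' : ∀ i ∈ s, ∑ l, x i l ^ 2 = 1 := fun i hi => by
    rw [← EuclideanSpace.real_norm_sq_eq, hx i hi, one_pow]
  -- The Fischer square of this weighted sum of zonal polynomials is c times the required quadratic
  -- form.
  have h0 := fischer_self_nonneg (∑ i ∈ s, MvPolynomial.C (w i) * zonal (x i) k)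
  simp only [fischer_sum_left, fischer_sum_right, fischer_C_mul_left, fischer_C_mul_right] at h0
  have h1 : ∑ i ∈ s, ∑ j ∈ s, w i * (w j * fischer (zonal (x i) k) (zonal (x j) k)) =
      c * ∑ i ∈ s, ∑ j ∈ s, w i * w j * (gegenbauer n k).eval (inner ℝ (x i) (x j)) := by
    simp only [Finset.mul_sum]
    refine Finset.sum_congr rfl fun i hi => Finset.sum_congr rfl fun j hj => ?_
    rw [h _ _ (isHomogeneous_zonal _ k) (laplacian_zonal hn (hx' j hj) k), eval_zonal (hx' i hi)]
    simp only [PiLp.inner_apply, RCLike.inner_apply, conj_trivial]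
    ring
  refine (mul_nonneg_iff_of_pos_left hc).1 (h0.trans_eq (Eq.trans ?_ h1))
  simp only [Finset.mul_sum]
  rw [Finset.sum_comm]
  exact Finset.sum_congr rfl fun i _ => Finset.sum_congr rfl fun j _ => by ring

/-- Positive definiteness at the two points x, y with weights (1, ±1) reads 2 ± 2 G_k(⟨x, y⟩) ≥ 0.
-/
theorem abs_gegenbauer_inner_le_one {n : ℕ} (hn : 2 ≤ n) (k : ℕ)
    {x y : EuclideanSpace ℝ (Fin n)} (hx : ‖x‖ = 1) (hy : ‖y‖ = 1) :
    |(gegenbauer n k).eval (inner ℝ x y)| ≤ 1 := by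
  have hxx : inner ℝ x x = (1 : ℝ) := by simp [hx]
  have hyy : inner ℝ y y = (1 : ℝ) := by simp [hy]
  have h (r : ℝ) := gegenbauer_posDef hn k Finset.univ ![x, y]
    (fun i _ => by fin_cases i <;> simp [hx, hy]) ![1, r]
  simp only [Fin.sum_univ_two, Matrix.cons_val_zero, Matrix.cons_val_one, hxx, hyy,
    real_inner_comm x y, gegenbauer_eval_one n hn] at h
  have h1 := h 1
  have h2 := h (-1)
  rw [abs_le]
  constructor <;> linarith

end CapCodes

/-! ### Codes in caps and existence of the maxima -/

namespace CapCodes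

open InnerProductGeometry

variable {n : ℕ}

theorem norm_northPole (hn : 1 ≤ n) : ‖northPole n‖ = 1 := by
  obtain ⟨m, rfl⟩ : ∃ m, n = m + 1 := ⟨n - 1, by omega⟩
  have h (i : Fin (m + 1)) : northPole (m + 1) i = if i = Fin.last m then 1 else 0 := by
    simp [northPole, Fin.ext_iff]
  have h1 : ‖northPole (m + 1)‖ ^ 2 = 1 := by
    rw [EuclideanSpace.real_norm_sq_eq]
    simp [h]
  exact (pow_eq_one_iff_of_nonneg (norm_nonneg _) two_ne_zero).1 h1

theorem mem_cap_iff (hn : 1 ≤ n) {φ : ℝ} {x : EuclideanSpace ℝ (Fin n)} :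
    x ∈ cap n φ ↔ ‖x‖ = 1 ∧ Real.cos φ ≤ inner ℝ x (northPole n) := by
  refine ⟨fun h => ⟨h.1, h.2.1⟩, fun h => ⟨h.1, h.2, ?_⟩⟩
  have := real_inner_le_norm x (northPole n)
  rwa [h.1, norm_northPole hn, one_mul, ← Real.cos_zero] at this

theorem cap_subset_sphere (n : ℕ) (φ : ℝ) :
    cap n φ ⊆ Metric.sphere (0 : EuclideanSpace ℝ (Fin n)) 1 := fun x hx => by
  simpa using hx.1

theorem IsCode.mono {θ : ℝ} {Z Z' : Set (EuclideanSpace ℝ (Fin n))}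
    {C C' : Finset (EuclideanSpace ℝ (Fin n))} (h : IsCode θ Z C) (hC : C' ⊆ C)
    (hZ : (C' : Set (EuclideanSpace ℝ (Fin n))) ⊆ Z') : IsCode θ Z' C' :=
  ⟨hZ, fun x hx y hy => h.2 x (hC hx) y (hC hy)⟩

/-- Compactness covers the sphere by finitely many open caps of angular radius θ/2; by the triangle
inequality for angles, each contains at most one code point. -/
theorem bddAbove_codeSizes {θ : ℝ} (hθ : 0 < θ) {Z : Set (EuclideanSpace ℝ (Fin n))}
    (hZ : Z ⊆ Metric.sphere 0 1) : BddAbove (codeSizes θ Z) := by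
  have hne (x : EuclideanSpace ℝ (Fin n)) (hx : x ∈ Metric.sphere 0 1) : x ≠ 0 := by
    rintro rfl
    simp at hx
  obtain ⟨t, -, ht⟩ := (isCompact_sphere (0 : EuclideanSpace ℝ (Fin n)) 1).elim_nhds_subcover
    (fun x => {y | angle x y < θ / 2}) (fun x hx => by
      have h1 : ContinuousAt (fun y => angle x y) x :=
        (continuousAt_angle (x := (x, x)) (hne x hx) (hne x hx)).comp
          (f := fun y => (x, y)) (by fun_prop)
      refine h1.eventually_lt continuousAt_const ?_
      rw [angle_self (hne x hx)]
      positivity)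
  refine ⟨t.card, ?_⟩
  rintro _ ⟨C, hC, rfl⟩
  have hcov (y : EuclideanSpace ℝ (Fin n)) (hy : y ∈ C) : ∃ x ∈ t, angle x y < θ / 2 := by
    simpa using ht (hZ (hC.1 hy))
  choose! g hg hg' using hcov
  by_contra! hlt
  obtain ⟨x, hx, y, hy, hxy, he⟩ := Finset.exists_ne_map_eq_of_card_lt_of_maps_to hlt hg
  have h1 := hC.2 x hx y hy hxy
  have h2 := angle_le_angle_add_angle x (g x) y
  have h3 := hg' x hx
  have h4 := hg' y hy
  rw [← he] at h4
  rw [angle_comm] at h3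
  linarith

theorem isGreatest_codeSizes {θ : ℝ} (hθ : 0 < θ) {Z : Set (EuclideanSpace ℝ (Fin n))}
    (hZ : Z ⊆ Metric.sphere 0 1) : IsGreatest (codeSizes θ Z) (sSup (codeSizes θ Z)) :=
  ⟨Nat.sSup_mem ⟨0, ∅, by simp [IsCode], rfl⟩ (bddAbove_codeSizes hθ hZ),
    fun _ hm => le_csSup (bddAbove_codeSizes hθ hZ) hm⟩

theorem angle_eq_arccos_inner {x y : EuclideanSpace ℝ (Fin n)} (hx : ‖x‖ = 1) (hy : ‖y‖ = 1) :
    angle x y = Real.arccos (inner ℝ x y) := by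
  rw [angle, hx, hy, one_mul, div_one]

/-- A sum of a Gegenbauer series with nonnegative coefficients is continuous on the sphere as a
function of a point's inner product with a fixed unit vector. -/
theorem continuousOn_inner_of_hasSum (hn : 2 ≤ n) {f : ℝ → ℝ} {a : ℕ → ℝ} (ha : ∀ k, 0 ≤ a k)
    (hf : ∀ t ∈ Set.Icc (-1 : ℝ) 1, HasSum (fun k => a k * (gegenbauer n k).eval t) (f t))
    {x : EuclideanSpace ℝ (Fin n)} (hx : ‖x‖ = 1) :
    ContinuousOn (fun y => f (inner ℝ x y)) (Metric.sphere 0 1) := by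
  -- Since G_k(1) = 1, convergence at t = 1 is summability of the coefficients, which then dominate
  -- the series as in the Weierstrass M-test.
  have hs : Summable a := by
    have := (hf 1 (by simp)).summable
    simpa [gegenbauer_eval_one n hn] using this
  have hy' (y : EuclideanSpace ℝ (Fin n)) (hy : y ∈ Metric.sphere 0 1) : ‖y‖ = 1 := by
    simpa using hy
  have hc : ContinuousOn (fun y => ∑' k, a k * (gegenbauer n k).eval (inner ℝ x y))
      (Metric.sphere 0 1) := by
    refine continuousOn_tsum (fun k => Continuous.continuousOn ?_) hs fun k y hy => ?_
    · exact continuous_const.mul ((gegenbauer n k).continuous.comp (by fun_prop))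
    · rw [norm_mul, Real.norm_of_nonneg (ha k)]
      exact mul_le_of_le_one_right (ha k) (abs_gegenbauer_inner_le_one hn k hx (hy' y hy))
  refine hc.congr fun y hy => ?_
  have h := abs_real_inner_le_norm x y
  rw [hx, hy' y hy, one_mul] at h
  exact (hf _ (abs_le.1 h)).tsum_eq.symm

/-- The values of `H_f` at the `m`-point `θ`-codes in a cap, parametrized by the ordered codes. -/
theorem hValues_eq_image {θ : ℝ} (hθ : 0 < θ) (φ : ℝ) (f : ℝ → ℝ) (m : ℕ) :
    hValues n θ φ f m = (fun y : Fin m → EuclideanSpace ℝ (Fin n) =>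
      f 1 + ∑ i, f (inner ℝ (-northPole n) (y i))) ''
        {y | (∀ i, y i ∈ cap n φ) ∧ ∀ i j, i ≠ j → θ ≤ Real.arccos (inner ℝ (y i) (y j))} := by
  classical
  ext v
  constructor
  · rintro ⟨Y, hY, hm, rfl⟩
    let e := Y.equivFinOfCardEq hm
    refine ⟨fun i => e.symm i, ⟨fun i => hY.1 (e.symm i).2, fun i j hij => ?_⟩, ?_⟩
    · rw [← angle_eq_arccos_inner (hY.1 (e.symm i).2).1 (hY.1 (e.symm j).2).1]
      exact hY.2 _ (e.symm i).2 _ (e.symm j).2 fun h =>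
        hij (e.symm.injective (Subtype.ext h))
    · rw [H, ← Finset.sum_coe_sort Y]
      exact congrArg (f 1 + ·) (e.symm.sum_comp fun y : Y => f (inner ℝ (-northPole n) (y : _)))
  · rintro ⟨y, ⟨hcap, hang⟩, rfl⟩
    -- Repeated points would be at angle arccos 1 = 0 < θ, so an ordered code really has m distinct
    -- points.
    have hinj : Function.Injective y := fun i j hij => by
      by_contra hne
      have := hang i j hne
      rw [hij, real_inner_self_eq_norm_sq, (hcap j).1, one_pow, Real.arccos_one] at this
      exact this.not_gt hθ
    refine ⟨Finset.univ.image y, ⟨?_, ?_⟩, ?_, ?_⟩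
    · intro z hz
      obtain ⟨i, -, rfl⟩ := Finset.mem_image.1 hz
      exact hcap i
    · intro x hx z hz hxz
      obtain ⟨i, -, rfl⟩ := Finset.mem_image.1 hx
      obtain ⟨j, -, rfl⟩ := Finset.mem_image.1 hz
      rw [angle_eq_arccos_inner (hcap i).1 (hcap j).1]
      exact hang i j fun h => hxz (congrArg y h)
    · rw [Finset.card_image_of_injective _ hinj, Finset.card_univ, Fintype.card_fin]
    · rw [H, Finset.sum_image hinj.injOn]

theorem isClosed_cap (n : ℕ) (φ : ℝ) : IsClosed (cap n φ) := by
  simp only [cap, strip, Set.ofPred_and]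
  refine (isClosed_eq continuous_norm continuous_const).inter
    ((isClosed_le continuous_const ?_).inter (isClosed_le ?_ continuous_const)) <;>
  fun_prop

/-- Ordered m-point codes form a closed subset of a power of the compact cap, and H_f is continuous
on it. Writing the separation with arccos makes it a closed condition on the whole space. -/
theorem isGreatest_hValues (hn : 2 ≤ n) {θ : ℝ} (hθ : 0 < θ) {φ : ℝ} {f : ℝ → ℝ} {a : ℕ → ℝ}
    (ha : ∀ k, 0 ≤ a k)
    (hf : ∀ t ∈ Set.Icc (-1 : ℝ) 1, HasSum (fun k => a k * (gegenbauer n k).eval t) (f t))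
    {m : ℕ} (hm : m ≤ maxCapCode n θ φ) : IsGreatest (hValues n θ φ f m) (h n θ φ f m) := by
  have hcap : IsCompact (cap n φ) :=
    (isCompact_sphere _ _).of_isClosed_subset (isClosed_cap n φ) (cap_subset_sphere n φ)
  have hcompact : IsCompact {y : Fin m → EuclideanSpace ℝ (Fin n) | (∀ i, y i ∈ cap n φ) ∧
      ∀ i j, i ≠ j → θ ≤ Real.arccos (inner ℝ (y i) (y j))} := by
    have h1 : IsClosed {y : Fin m → EuclideanSpace ℝ (Fin n) |
        ∀ i j, i ≠ j → θ ≤ Real.arccos (inner ℝ (y i) (y j))} := by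
      simp only [Set.ofPred_forall]
      refine isClosed_iInter fun i => isClosed_iInter fun j => isClosed_iInter fun _ =>
        isClosed_le continuous_const (Real.continuous_arccos.comp (by fun_prop))
    exact (isCompact_pi_infinite fun _ => hcap).inter_right h1
  have hnorm : ‖-northPole n‖ = 1 := by rw [norm_neg, norm_northPole (by omega)]
  have hcont : ContinuousOn (fun y : Fin m → EuclideanSpace ℝ (Fin n) =>
      f 1 + ∑ i, f (inner ℝ (-northPole n) (y i)))
      {y | (∀ i, y i ∈ cap n φ) ∧ ∀ i j, i ≠ j → θ ≤ Real.arccos (inner ℝ (y i) (y j))} :=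
    continuousOn_const.add <| continuousOn_finsetSum _ fun i _ =>
      (continuousOn_inner_of_hasSum hn ha hf hnorm).comp (continuous_apply i).continuousOn
        fun y hy => cap_subset_sphere n φ (hy.1 i)
  refine IsCompact.isGreatest_sSup ?_ ?_
  · rw [hValues_eq_image hθ]
    exact hcompact.image_of_continuousOn hcont
  -- An m-point code exists for every m up to the maximum: discard points from a largest code.
  · obtain ⟨C, hC, hcard⟩ := (isGreatest_codeSizes hθ (cap_subset_sphere n φ)).1
    obtain ⟨Y, hY, hYm⟩ := Finset.exists_subset_card_eq (hm.trans_eq hcard.symm)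
    exact ⟨_, Y, hC.mono hY (subset_trans (Finset.coe_subset.2 hY) hC.1), hYm, rfl⟩

/-! ### The two estimates of the energy and the bound -/

/-- The points of a spherical code in the cap opposite to `x` can be rotated to the north pole. -/
theorem sum_inner_le_hMax (hn : 2 ≤ n) {θ : ℝ} (hθ : 0 < θ) {φ : ℝ} {f : ℝ → ℝ} {a : ℕ → ℝ}
    (ha : ∀ k, 0 ≤ a k)
    (hf : ∀ t ∈ Set.Icc (-1 : ℝ) 1, HasSum (fun k => a k * (gegenbauer n k).eval t) (f t))
    (hneg : ∀ t ∈ Set.Icc (-Real.cos φ) (Real.cos θ), f t ≤ 0)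
    {C : Finset (EuclideanSpace ℝ (Fin n))} (hC : IsCode θ (Metric.sphere 0 1) C)
    {x : EuclideanSpace ℝ (Fin n)} (hx : x ∈ C) :
    ∑ y ∈ C, f (inner ℝ x y) ≤ hMax n θ φ f := by
  classical
  have hnorm (y : EuclideanSpace ℝ (Fin n)) (hy : y ∈ C) : ‖y‖ = 1 := by simpa using hC.1 hy
  have hlen : ‖-x‖ = ‖northPole n‖ := by rw [norm_neg, hnorm x hx, norm_northPole (by omega)]
  -- Any isometry will do; the reflection in the hyperplane orthogonal to -x - e_n serves.
  obtain ⟨R, hR⟩ : ∃ R : EuclideanSpace ℝ (Fin n) ≃ₗᵢ[ℝ] EuclideanSpace ℝ (Fin n),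
      R (-x) = northPole n := ⟨_, Submodule.reflection_sub hlen⟩
  have hRx (y : EuclideanSpace ℝ (Fin n)) :
      inner ℝ (-northPole n) (R y) = (inner ℝ x y : ℝ) := by
    rw [← hR, map_neg, neg_neg, R.inner_map_map]
  let D := (C.erase x).filter fun y => inner ℝ x y < -Real.cos φ
  let Y := D.image R
  have hD (y : EuclideanSpace ℝ (Fin n)) (hy : y ∈ D) : y ∈ C :=
    Finset.mem_of_mem_erase (Finset.mem_filter.1 hy).1
  have hY : IsCode θ (cap n φ) Y := by
    constructor
    · intro z hz
      obtain ⟨y, hy, rfl⟩ := Finset.mem_image.1 hz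
      refine (mem_cap_iff (by omega)).2 ⟨by rw [R.norm_map, hnorm y (hD y hy)], ?_⟩
      have h1 := (Finset.mem_filter.1 hy).2
      rw [← hRx, inner_neg_left, real_inner_comm] at h1
      linarith
    · intro z hz w hw hzw
      obtain ⟨y, hy, rfl⟩ := Finset.mem_image.1 hz
      obtain ⟨u, hu, rfl⟩ := Finset.mem_image.1 hw
      have h1 := hC.2 y (hD y hy) u (hD u hu) fun h => hzw (congrArg R h)
      rwa [← R.toLinearIsometry.angle_map] at h1
  have hH : H n f Y = f 1 + ∑ y ∈ D, f (inner ℝ x y) := by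
    rw [H, Finset.sum_image R.injective.injOn]
    simp only [hRx]
  have hle : ∑ y ∈ C, f (inner ℝ x y) ≤ H n f Y := by
    rw [hH, ← Finset.add_sum_erase C _ hx, real_inner_self_eq_norm_sq, hnorm x hx, one_pow,
      ← Finset.sum_filter_add_sum_filter_not (C.erase x) fun y => inner ℝ x y < -Real.cos φ]
    -- For the remaining points the code separation gives ⟨x, y⟩ ≤ cos θ, so the sign hypothesis on
    -- f applies.
    have h0 : ∑ y ∈ (C.erase x).filter (fun y => ¬ inner ℝ x y < -Real.cos φ),
        f (inner ℝ x y) ≤ 0 := by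
      refine Finset.sum_nonpos fun y hy => hneg _ ?_
      obtain ⟨hy1, hy2⟩ := Finset.mem_filter.1 hy
      obtain ⟨hyx, hyC⟩ := Finset.mem_erase.1 hy1
      refine ⟨not_lt.1 hy2, ?_⟩
      have h1 := Real.cos_le_cos_of_nonneg_of_le_pi hθ.le (angle_le_pi x y)
        (hC.2 x hx y hyC hyx.symm)
      rwa [cos_angle, hnorm x hx, hnorm y hyC, one_mul, div_one] at h1
    linarith
  have hcard : Y.card ≤ maxCapCode n θ φ :=
    (isGreatest_codeSizes hθ (cap_subset_sphere n φ)).2 ⟨Y, hY, rfl⟩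
  calc ∑ y ∈ C, f (inner ℝ x y) ≤ H n f Y := hle
    _ ≤ h n θ φ f Y.card := (isGreatest_hValues hn hθ ha hf hcard).2 ⟨Y, hY, rfl, rfl⟩
    _ ≤ hMax n θ φ f := Finset.le_sup' (h n θ φ f) (Finset.mem_range.2 (by omega))

/-- Delsarte's lower bound for the energy of a finite subset of the sphere. -/
theorem mul_card_sq_le_sum (hn : 2 ≤ n) {f : ℝ → ℝ} {a : ℕ → ℝ} (ha : ∀ k, 0 ≤ a k)
    (hf : ∀ t ∈ Set.Icc (-1 : ℝ) 1, HasSum (fun k => a k * (gegenbauer n k).eval t) (f t))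
    {C : Finset (EuclideanSpace ℝ (Fin n))} (hC : ∀ x ∈ C, ‖x‖ = 1) :
    a 0 * (C.card : ℝ) ^ 2 ≤ ∑ x ∈ C, ∑ y ∈ C, f (inner ℝ x y) := by
  have hsum : HasSum (fun k => ∑ x ∈ C, ∑ y ∈ C, a k * (gegenbauer n k).eval (inner ℝ x y))
      (∑ x ∈ C, ∑ y ∈ C, f (inner ℝ x y)) := by
    refine hasSum_sum fun x hx => hasSum_sum fun y hy => hf _ ?_
    have h := abs_real_inner_le_norm x y
    rw [hC x hx, hC y hy, one_mul] at h
    exact abs_le.1 h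
  have hpos (k : ℕ) : 0 ≤ ∑ x ∈ C, ∑ y ∈ C, a k * (gegenbauer n k).eval (inner ℝ x y) := by
    have h := gegenbauer_posDef hn k C id hC fun _ => 1
    simp only [mul_one, one_mul, id] at h
    simp only [← Finset.mul_sum]
    exact mul_nonneg (ha k) h
  -- Keep only k = 0: as G_0 = 1, that term is a_0 |C|².
  have h := le_hasSum hsum 0 fun k _ => hpos k
  simp only [gegenbauer, Polynomial.eval_one, mul_one, Finset.sum_const, nsmul_eq_mul] at h
  linarith

end CapCodes

theorem theorem2 (n : ℕ) (hn : 2 ≤ n) (θ φ : ℝ) (hθ : 0 < θ) (hφ₀ : 0 ≤ φ)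
    (hφ : φ ≤ Real.pi / 2) (f : ℝ → ℝ) (a : ℕ → ℝ) (ha : ∀ k, 0 ≤ a k) (ha₀ : 0 < a 0)
    (hf : ∀ t ∈ Set.Icc (-1 : ℝ) 1,
      HasSum (fun k => a k * (CapCodes.gegenbauer n k).eval t) (f t))
    (hneg : ∀ t ∈ Set.Icc (-Real.cos φ) (Real.cos θ), f t ≤ 0) :
    -- the maxima in the definitions of `A(n, θ)`, `A(n, θ, φ)` and `h_m` are attained
    IsGreatest (CapCodes.codeSizes θ (Metric.sphere (0 : EuclideanSpace ℝ (Fin n)) 1))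
      (CapCodes.maxSphericalCode n θ) ∧
    IsGreatest (CapCodes.codeSizes θ (CapCodes.cap n φ)) (CapCodes.maxCapCode n θ φ) ∧
    (∀ m ≤ CapCodes.maxCapCode n θ φ,
      IsGreatest (CapCodes.hValues n θ φ f m) (CapCodes.h n θ φ f m)) ∧
    (CapCodes.maxSphericalCode n θ : ℝ) ≤ CapCodes.hMax n θ φ f / a 0 := by
  have hA := CapCodes.isGreatest_codeSizes hθ
    (subset_refl (Metric.sphere (0 : EuclideanSpace ℝ (Fin n)) 1))
  refine ⟨hA, CapCodes.isGreatest_codeSizes hθ (CapCodes.cap_subset_sphere n φ),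
    fun m hm => CapCodes.isGreatest_hValues hn hθ ha hf hm, ?_⟩
  obtain ⟨C, hC, hcard⟩ := hA.1
  -- A one-point code shows that the largest code is nonempty, so one factor |C| can be cancelled at
  -- the end.
  have hpole : CapCodes.IsCode θ (Metric.sphere 0 1) {CapCodes.northPole n} := by
    refine ⟨by simp [CapCodes.norm_northPole (show 1 ≤ n by omega)], fun x hx y hy hxy => ?_⟩
    rw [Finset.mem_singleton] at hx hy
    exact absurd (hx.trans hy.symm) hxy
  have hone : 1 ≤ C.card := hcard ▸ hA.2 ⟨_, hpole, Finset.card_singleton _⟩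
  have hone' : (0 : ℝ) < C.card := by exact_mod_cast hone
  have h1 := CapCodes.mul_card_sq_le_sum hn ha hf (C := C) fun x hx => by simpa using hC.1 hx
  have h2 : ∑ x ∈ C, ∑ y ∈ C, f (inner ℝ x y) ≤ C.card * CapCodes.hMax n θ φ f := by
    rw [← nsmul_eq_mul]
    exact Finset.sum_le_card_nsmul _ _ _ fun x hx =>
      CapCodes.sum_inner_le_hMax hn hθ ha hf hneg hC hx
  rw [CapCodes.maxSphericalCode, ← hcard, le_div_iff₀ ha₀]
  refine le_of_mul_le_mul_left ?_ hone'
  linarith
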